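/- A $k$-hypergraph on a finite set $V$ is a set $g\subseteq V^k$ of $k$-tuples (repeated vertices are allowed) that is invariant under permutations of the coordinates; a $k$-distinguishing class is a set of $k$-hypergraphs on $V$. For a probability distribution $p$ on $V$ put $L_p(g)=p^{k}(g)$, the probability that $k$ independent draws from $p$ form an element of $g$, and for a $k$-distinguishing class $\mathcal G$ put $\mathrm{IPM}_{\mathcal G}(p_1,p_2)=\sup_{g\in\mathcal G}|L_{p_1}(g)-L_{p_2}(g)|$ (equal to $0$ if $\mathcal G=\emptyset$). The class $\mathcal G$ has sample complexity (at most) $m(\epsilon,\delta)$, for $\epsilon,\delta\in(0,1)$, if there is an algorithm, i.e. a map that assigns to each pair $(S_1,S_2)$ of finite samples of vertices a hypergraph $g_S\in\mathcal G$, such that for all $\epsilon,\delta\in(0,1)$ and all distributions $p_1,p_2$ on $V$: if $S_1$ and $S_2$ are independent i.i.d. samples from $p_1$ and $p_2$, each of size greater than $m(\epsilon,\delta)$, then with probability at least $1-\delta$ we have $|L_{p_1}(g_S)-L_{p_2}(g_S)|>\mathrm{IPM}_{\mathcal G}(p_1,p_2)-\epsilon$. The graph VC dimension $\mathrm{gVC}(\mathcal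 G)$ is the VC dimension if $k=1$ (a $1$-hypergraph being a subset of $V$), and for $k>1$ it is $\max_{v\in V}\mathrm{gVC}(\mathcal G_v)$, where $\mathcal G_v=\{g_v: g\in\mathcal G\}$ and $g_v=\{(u_1,\dots,u_{k-1}):(v,u_1,\dots,u_{k-1})\in g\}$; the empty class has graph VC dimension $0$. Theorem. There are absolute constants $C,c>0$ such that for every $k\ge 2$ and every finite set $V$ with $|V|=n\ge 3$ there is a $k$-distinguishing class $\mathcal G_k$ on $V$ with $|\mathcal G_k|=1$ such that: (1) $\mathcal G_k$ has sample complexity $m(\epsilon,\delta)\le C\,\frac{k^2+\log(1/\delta)}{\epsilon^2}$ for all $\epsilon,\delta\in(0,1)$; (2) for every $\epsilon>0$ and every $(k-1)$-distinguishing class $\mathcal G_{k-1}$ on $V$, if $\mathrm{IPM}_{\mathcal G_{k-1}}(p_1,p_2)\ge\epsilon\cdot\mathrm{IPM}_{\mathcal G_k}(p_1,p_2)$ for all distributions $p_1,p_2$ on $V$, then $$\mathrm{gVC}(\mathcal G_{k-1})\ \ge\ c\,\frac{\epsilon^2}{k^2}\sqrt{\log n}.$$ -/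

import Mathlib

open scoped BigOperators

noncomputable section

/-- An undirected `k`-hypergraph on the vertex set `V`: a set of `k`-tuples of vertices (tuples may
repeat a vertex) that is invariant under permutations of the coordinates. -/
@[ext]
structure KHypergraph (V : Type*) (k : ℕ) where
  edges : Set (Fin k → V)
  undirected : ∀ (π : Equiv.Perm (Fin k)) (v : Fin k → V), v ∈ edges → v ∘ π ∈ edges

namespace KHypergraph

/-- The projection `g_v` of a `(k+1)`-hypergraph: the first vertex of an edge is fixed to be `v`. -/
def proj {V : Type*} {k : ℕ} (g : KHypergraph V (k + 1)) (v : V) : KHypergraph V k where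
  edges := {u | (Fin.cons v u : Fin (k + 1) → V) ∈ g.edges}
  undirected := by
    intro π u hu
    have h := g.undirected (Equiv.Perm.decomposeFin.symm (0, π)) _ hu
    have e : (Fin.cons v u : Fin (k + 1) → V) ∘ (Equiv.Perm.decomposeFin.symm (0, π)) =
        (Fin.cons v (u ∘ π) : Fin (k + 1) → V) := by
      funext i
      refine Fin.cases ?_ (fun j => ?_) i <;> simp
    simpa [e] using h

end KHypergraph

open Classical in
/-- The probability of the event `E` when the coordinates of a `k`-tuple are drawn independently
from the distribution `P` on the finite set `V`. -/
def iidProb {V : Type*} [Fintype V] {k : ℕ} (P : PMF V) (E : Set (Fin k → V)) : ℝ :=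
  ∑ v : Fin k → V, if v ∈ E then ∏ i, (P (v i)).toReal else 0

/-- The frequency of the edges of `g` under `P`. -/
def edgeFreq {V : Type*} [Fintype V] {k : ℕ} (P : PMF V) (g : KHypergraph V k) : ℝ :=
  iidProb P g.edges

/-- The integral probability metric of a class of `k`-hypergraphs. The values lie in `[0, 1]`;
for the empty class the supremum is `0`. -/
def ipm {V : Type*} [Fintype V] {k : ℕ} (G : Set (KHypergraph V k)) (p₁ p₂ : PMF V) : ℝ :=
  ⨆ g : G, |edgeFreq p₁ g.1 - edgeFreq p₂ g.1|

open Classical in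
/-- The probability of an event about a pair of independent samples, `S₁` consisting of `m₁`
independent draws from `p₁`, and `S₂` consisting of `m₂` independent draws from `p₂`. -/
def twoSampleProb {V : Type*} [Fintype V] (p₁ p₂ : PMF V) (m₁ m₂ : ℕ)
    (E : Set ((Fin m₁ → V) × (Fin m₂ → V))) : ℝ :=
  ∑ S₁ : Fin m₁ → V, ∑ S₂ : Fin m₂ → V,
    if (S₁, S₂) ∈ E then (∏ i, (p₁ (S₁ i)).toReal) * ∏ j, (p₂ (S₂ j)).toReal else 0

/-- `A`, which maps a pair of finite samples to an element of `G`, is a `G`-discriminating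
algorithm with sample complexity `m`. -/
def IsDiscriminatingAlgorithm {V : Type*} [Fintype V] {k : ℕ} (G : Set (KHypergraph V k))
    (A : ∀ m₁ m₂ : ℕ, (Fin m₁ → V) → (Fin m₂ → V) → G) (m : ℝ → ℝ → ℕ) : Prop :=
  ∀ ε δ : ℝ, 0 < ε → ε < 1 → 0 < δ → δ < 1 →
    ∀ (p₁ p₂ : PMF V) (m₁ m₂ : ℕ), m ε δ < m₁ → m ε δ < m₂ →
      1 - δ ≤ twoSampleProb p₁ p₂ m₁ m₂
        {S | ipm G p₁ p₂ - ε <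
          |edgeFreq p₁ (A m₁ m₂ S.1 S.2).1 - edgeFreq p₂ (A m₁ m₂ S.1 S.2).1|}

/-- Some `G`-discriminating algorithm has sample complexity `m`, that is, the sample complexity
of `G` is at most `m`. -/
def HasSampleComplexity {V : Type*} [Fintype V] {k : ℕ} (G : Set (KHypergraph V k))
    (m : ℝ → ℝ → ℕ) : Prop :=
  ∃ A : ∀ m₁ m₂ : ℕ, (Fin m₁ → V) → (Fin m₂ → V) → G, IsDiscriminatingAlgorithm G A m

open Classical in
/-- The VC dimension of a class of `1`-hypergraphs, which are identified with subsets of `V`. -/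
def vcDimension {V : Type*} [Fintype V] (G : Set (KHypergraph V 1)) : ℕ :=
  Finset.vcDim (Finset.univ.filter
    fun D : Finset V => ∃ g ∈ G, ∀ v : V, v ∈ D ↔ (fun _ => v) ∈ g.edges)

/-- The graph VC dimension. (The value at `k = 0` plays no role.) -/
def gVC {V : Type*} [Fintype V] : (k : ℕ) → Set (KHypergraph V k) → ℕ
  | 0, _ => 0
  | 1, G => vcDimension G
  | k + 2, G => Finset.univ.sup fun v : V => gVC (k + 1) ((fun g => g.proj v) '' G)

end

/-!
The separating hypergraph is built from Shamir's secret sharing. Its vertices are the possible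
values of the shares and of the bits of a secret, and an edge consists of one bit of the secret and
`k - 1` shares of one dealing, which determine the secret. For a fixed dealing, the distribution
that shows its shares and its secret sees many edges, the one that shows its shares and the
complement of the secret sees none. Replacing one entry at a time (hybrid argument), a
`(k - 1)`-hypergraph tells them apart only through the correlation of the secret with a link of
`k - 2` vertices. Since `k - 2` shares are independent of the secret, and by Sauer-Shelah the links
have few traces on the bits, Hoeffding's inequality and a union bound give a dealing for which all
these correlations are small, unless the graph VC dimension is large.

That the graph VC dimension is at least `1`, which settles small `n`, is ensured by three further
vertices. A class of graph VC dimension `0` has at most one member `h`; after passing to the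
complement, `h` omits the constant tuple at `base`. Drawing `loop` with a small probability `α`, and
`base` otherwise, gives `h` a frequency of at least `α ^ (k - 1)` and the separating hypergraph only
`α ^ k`. Drawing instead `hub` with the probability `γ` at which `h` has the same frequency forces
`γ` to be of order `α ^ (k - 1)`, which is also at most the frequency of the separating hypergraph.
-/

section Probability

variable {V Ω : Type*} [Fintype Ω]

lemma toReal_map_apply [DecidableEq V] (P : PMF Ω) (φ : Ω → V) (v : V) :
    (P.map φ v).toReal = ∑ ω, if φ ω = v then (P ω).toReal else 0 := by
  rw [PMF.map_apply, tsum_fintype,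
    ENNReal.toReal_sum fun ω _ => by split_ifs <;> simp [P.apply_ne_top]]
  exact Finset.sum_congr rfl fun ω _ => by
    split_ifs <;> simp_all

variable [Fintype V] {k : ℕ}

lemma sum_toReal_pmf (P : PMF V) : ∑ v, (P v).toReal = 1 := by
  rw [← ENNReal.toReal_sum fun v _ => P.apply_ne_top v, ← tsum_fintype (L := .unconditional _),
    P.tsum_coe, ENNReal.toReal_one]

lemma sum_prod_toReal_pmf (P : PMF V) : ∑ v : Fin k → V, ∏ i, (P (v i)).toReal = 1 := by
  simpa [sum_toReal_pmf] using (Fintype.prod_sum fun (_ : Fin k) v => (P v).toReal).symm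

lemma sum_map_mul (P : PMF Ω) (φ : Ω → V) (f : V → ℝ) :
    ∑ v, (P.map φ v).toReal * f v = ∑ ω, (P ω).toReal * f (φ ω) := by
  classical
  simp only [toReal_map_apply, Finset.sum_mul, ite_mul, zero_mul]
  rw [Finset.sum_comm]
  simp

lemma iidProb_nonneg (P : PMF V) (E : Set (Fin k → V)) : 0 ≤ iidProb P E :=
  Finset.sum_nonneg fun v _ => by split_ifs <;> positivity

lemma iidProb_mono (P : PMF V) {E E' : Set (Fin k → V)} (h : E ⊆ E') :
    iidProb P E ≤ iidProb P E' :=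
  Finset.sum_le_sum fun v _ => by
    by_cases hv : v ∈ E
    · simp [hv, h hv]
    · simp only [hv, if_false]
      split_ifs <;> positivity

lemma iidProb_univ (P : PMF V) : iidProb P (Set.univ : Set (Fin k → V)) = 1 := by
  simp [iidProb, sum_prod_toReal_pmf]

lemma iidProb_le_one (P : PMF V) (E : Set (Fin k → V)) : iidProb P E ≤ 1 :=
  (iidProb_mono P E.subset_univ).trans_eq (iidProb_univ P)

lemma iidProb_compl (P : PMF V) (E : Set (Fin k → V)) : iidProb P Eᶜ = 1 - iidProb P E := by
  rw [eq_sub_iff_add_eq, ← sum_prod_toReal_pmf (k := k) P, iidProb, iidProb,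
    ← Finset.sum_add_distrib]
  exact Finset.sum_congr rfl fun v _ => by by_cases hv : v ∈ E <;> simp [hv]

lemma iidProb_singleton (P : PMF V) (v : Fin k → V) :
    iidProb P {v} = ∏ i, (P (v i)).toReal := by
  rw [iidProb, Finset.sum_eq_single v] <;> simp +contextual

lemma iidProb_map (P : PMF Ω) (φ : Ω → V) (E : Set (Fin k → V)) :
    iidProb (P.map φ) E = iidProb P {ω | φ ∘ ω ∈ E} := by
  classical
  have weight (v : Fin k → V) : ∏ i, (P.map φ (v i)).toReal =
      ∑ ω : Fin k → Ω, if φ ∘ ω = v then ∏ i, (P (ω i)).toReal else 0 := by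
    simp only [toReal_map_apply, Finset.prod_univ_sum, Fintype.piFinset_univ,
      Finset.prod_ite_zero, funext_iff, Finset.mem_univ, true_imp_iff, Function.comp_apply]
  calc iidProb (P.map φ) E
      = ∑ v : Fin k → V, ∑ ω : Fin k → Ω,
          if φ ∘ ω = v then (if φ ∘ ω ∈ E then ∏ i, (P (ω i)).toReal else 0) else 0 := by
        refine Finset.sum_congr rfl fun v _ => ?_
        rw [weight]
        split_ifs with hv
        · exact Finset.sum_congr rfl fun ω _ => by split_ifs <;> simp_all
        · exact (Finset.sum_eq_zero fun ω _ => by split_ifs <;> simp_all).symm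
    _ = iidProb P {ω | φ ∘ ω ∈ E} := by
        rw [Finset.sum_comm]
        simp [iidProb]

open Classical in
lemma iidProb_pure (x : V) (E : Set (Fin k → V)) :
    iidProb (PMF.pure x) E = if (fun _ => x) ∈ E then 1 else 0 := by
  rw [show PMF.pure x = (PMF.pure ()).map fun _ => x from
    (PMF.pure_map (fun _ => x) ()).symm, iidProb_map]
  have constant (ω : Fin k → Unit) : (fun _ => x) ∘ ω = fun _ => x := rfl
  simp [iidProb, constant]

lemma card_div_pow_le_iidProb_uniformOfFintype {ι : Type*} [Fintype ι] [Nonempty V]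
    {E : Set (Fin k → V)} (x : ι ↪ (Fin k → V)) (hx : ∀ a, x a ∈ E) :
    (Fintype.card ι : ℝ) / (Fintype.card V : ℝ) ^ k ≤ iidProb (PMF.uniformOfFintype V) E := by
  classical
  have hcard : Fintype.card ι ≤ (Finset.univ.filter (· ∈ E)).card := by
    simpa using Finset.card_le_card_of_injOn x (s := .univ) (by simp [hx]) x.injective.injOn
  calc (Fintype.card ι : ℝ) / (Fintype.card V : ℝ) ^ k
      ≤ (Finset.univ.filter (· ∈ E)).card / (Fintype.card V : ℝ) ^ k := by gcongr
    _ = iidProb (PMF.uniformOfFintype V) E := by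
        simp only [iidProb, PMF.uniformOfFintype_apply, ENNReal.toReal_inv, ENNReal.toReal_natCast,
          Finset.prod_const, Finset.card_univ, Fintype.card_fin, ← Finset.sum_filter,
          Finset.sum_const, nsmul_eq_mul, inv_pow, div_eq_mul_inv]

end Probability

section IntegralProbabilityMetric

variable {V : Type*} [Fintype V] {k : ℕ}

lemma ipm_le {G : Set (KHypergraph V k)} {p₁ p₂ : PMF V} {B : ℝ} (hB : 0 ≤ B)
    (h : ∀ g ∈ G, |edgeFreq p₁ g - edgeFreq p₂ g| ≤ B) : ipm G p₁ p₂ ≤ B :=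
  Real.iSup_le (fun g => h g.1 g.2) hB

lemma ipm_le_one (G : Set (KHypergraph V k)) (p₁ p₂ : PMF V) : ipm G p₁ p₂ ≤ 1 :=
  ipm_le zero_le_one fun g _ => abs_sub_le_of_nonneg_of_le (iidProb_nonneg p₁ g.edges)
    (iidProb_le_one p₁ g.edges) (iidProb_nonneg p₂ g.edges) (iidProb_le_one p₂ g.edges)

lemma ipm_singleton (g : KHypergraph V k) (p₁ p₂ : PMF V) :
    ipm {g} p₁ p₂ = |edgeFreq p₁ g - edgeFreq p₂ g| := by
  rw [ipm, ciSup_unique]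
  rfl

lemma twoSampleProb_univ (p₁ p₂ : PMF V) (m₁ m₂ : ℕ) :
    twoSampleProb p₁ p₂ m₁ m₂ Set.univ = 1 := by
  simp only [twoSampleProb, Set.mem_univ, if_true, ← Finset.mul_sum, sum_prod_toReal_pmf, mul_one]

lemma hasSampleComplexity_singleton (g : KHypergraph V k) :
    HasSampleComplexity {g} fun _ _ => 0 := by
  refine ⟨fun _ _ _ _ => ⟨g, rfl⟩, fun ε δ hε _ hδ _ p₁ p₂ m₁ m₂ _ _ => ?_⟩
  have always : {_S : (Fin m₁ → V) × (Fin m₂ → V) | ipm {g} p₁ p₂ - ε <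
      |edgeFreq p₁ g - edgeFreq p₂ g|} = Set.univ := by
    ext
    simpa [ipm_singleton] using hε
  simp only [always, twoSampleProb_univ]
  linarith

end IntegralProbabilityMetric

section Coin

/-- The distribution of a coin that shows `true` with probability `t`. -/
noncomputable def coin (t : unitInterval) : PMF Bool :=
  PMF.ofFintype (fun b => ENNReal.ofReal (bif b then (t : ℝ) else 1 - t)) <| by
    simp [← ENNReal.ofReal_add t.2.1 (sub_nonneg.2 t.2.2)]

variable {k : ℕ}

lemma toReal_coin_apply (t : unitInterval) (b : Bool) :
    (coin t b).toReal = bif b then (t : ℝ) else 1 - t := by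
  cases b <;> simp [coin, t.2.1, t.2.2]

lemma continuous_iidProb_coin (E : Set (Fin k → Bool)) :
    Continuous fun t => iidProb (coin t) E := by
  refine continuous_finsetSum _ fun ω _ => ?_
  split_ifs
  · refine continuous_finsetProd _ fun i _ => ?_
    simp only [toReal_coin_apply]
    cases ω i <;> simp only [cond_true, cond_false] <;> fun_prop
  · exact continuous_const

lemma coin_zero : coin 0 = PMF.pure false := by
  ext b
  cases b <;> simp [coin]

lemma coin_one : coin 1 = PMF.pure true := by
  ext b
  cases b <;> simp [coin]

lemma iidProb_coin_forall (t : unitInterval) :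
    iidProb (coin t) {ω : Fin k → Bool | ∀ i, ω i = true} = (t : ℝ) ^ k := by
  have constant : {ω : Fin k → Bool | ∀ i, ω i = true} = {fun _ => true} :=
    Set.ext fun ω => funext_iff.symm
  simp [constant, iidProb_singleton, toReal_coin_apply]

lemma iidProb_coin_exists (t : unitInterval) :
    iidProb (coin t) {ω : Fin k → Bool | ∃ i, ω i = true} = 1 - (1 - (t : ℝ)) ^ k := by
  have complement : {ω : Fin k → Bool | ∃ i, ω i = true} = {fun _ => false}ᶜ :=
    Set.ext fun ω => by simp [funext_iff]
  simp [complement, iidProb_compl, iidProb_singleton, toReal_coin_apply]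

/-- The distribution that draws `x` with probability `t` and `y` otherwise. -/
noncomputable def twoPoint {V : Type*} (x y : V) (t : unitInterval) : PMF V :=
  (coin t).map fun b => bif b then x else y

variable {V : Type*} {x y : V}

lemma twoPoint_zero : twoPoint x y 0 = PMF.pure y := by
  simp [twoPoint, coin_zero, PMF.pure_map]

lemma twoPoint_one : twoPoint x y 1 = PMF.pure x := by
  simp [twoPoint, coin_one, PMF.pure_map]

variable [Fintype V] {E : Set (Fin k → V)}

lemma continuous_iidProb_twoPoint : Continuous fun t => iidProb (twoPoint x y t) E := by
  simp only [twoPoint, iidProb_map]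
  exact continuous_iidProb_coin _

lemma pow_le_iidProb_twoPoint (hx : (fun _ => x) ∈ E) (t : unitInterval) :
    (t : ℝ) ^ k ≤ iidProb (twoPoint x y t) E := by
  rw [twoPoint, iidProb_map, ← iidProb_coin_forall]
  refine iidProb_mono _ fun ω hω => ?_
  obtain rfl : ω = fun _ => true := funext hω
  exact hx

lemma iidProb_twoPoint_le (hy : (fun _ => y) ∉ E) (t : unitInterval) :
    iidProb (twoPoint x y t) E ≤ k * t := by
  have subset_exists :
      {ω : Fin k → Bool | (fun b => bif b then x else y) ∘ ω ∈ E} ⊆ {ω | ∃ i, ω i = true} := by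
    intro ω hω
    by_contra hnone
    obtain rfl : ω = fun _ => false :=
      funext fun i => Bool.eq_false_of_not_eq_true fun h => hnone ⟨i, h⟩
    exact hy hω
  calc iidProb (twoPoint x y t) E
      ≤ 1 - (1 - (t : ℝ)) ^ k := by
        rw [twoPoint, iidProb_map, ← iidProb_coin_exists]
        exact iidProb_mono _ subset_exists
    _ ≤ k * t := by
        have bernoulli := one_add_mul_le_pow (a := -(t : ℝ)) (by linarith [t.2.2]) k
        rw [← sub_eq_add_neg] at bernoulli
        linarith

end Coin

section Anchors

variable {V : Type*} {k : ℕ} {loop base hub : V}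

/-- A set of tuples is anchored at `loop`, `base` and `hub` if it contains a tuple of the vertices
`loop` and `base` exactly when all entries are `loop`, and a tuple of the vertices `hub` and `base`
exactly when some entry is `hub`. -/
structure IsAnchored (G : Set (Fin k → V)) (loop base hub : V) : Prop where
  loop_mem_iff (ω : Fin k → Bool) : (fun i => bif ω i then loop else base) ∈ G ↔ ∀ i, ω i = true
  hub_mem_iff (ω : Fin k → Bool) : (fun i => bif ω i then hub else base) ∈ G ↔ ∃ i, ω i = true

/-- The tuples with all entries `loop` or some entry `hub`. -/
def anchorEdges (k : ℕ) (loop hub : V) : Set (Fin k → V) :=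
  {v | (∀ i, v i = loop) ∨ ∃ i, v i = hub}

lemma comp_mem_anchorEdges (π : Equiv.Perm (Fin k)) {v : Fin k → V}
    (hv : v ∈ anchorEdges k loop hub) : v ∘ π ∈ anchorEdges k loop hub :=
  hv.imp (fun h i => h (π i)) fun ⟨i, hi⟩ => ⟨π.symm i, by simpa using hi⟩

lemma isAnchored_anchorEdges [NeZero k] (hlb : loop ≠ base) (hlh : loop ≠ hub) (hbh : base ≠ hub) :
    IsAnchored (anchorEdges k loop hub) loop base hub where
  loop_mem_iff ω := by
    have entry_eq_loop (b : Bool) : (bif b then loop else base) = loop ↔ b = true := by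
      cases b <;> simp [hlb.symm]
    have entry_ne_hub (b : Bool) : (bif b then loop else base) ≠ hub := by
      cases b <;> simp [hlh, hbh]
    simp [anchorEdges, entry_eq_loop, entry_ne_hub]
  hub_mem_iff ω := by
    have entry_ne_loop (b : Bool) : (bif b then hub else base) ≠ loop := by
      cases b <;> simp [hlb.symm, hlh.symm]
    have entry_eq_hub (b : Bool) : (bif b then hub else base) = hub ↔ b = true := by
      cases b <;> simp [hbh]
    simp [anchorEdges, entry_ne_loop, entry_eq_hub]

namespace IsAnchored

variable [Fintype V] {G : Set (Fin k → V)}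

lemma iidProb_loop (hG : IsAnchored G loop base hub) (t : unitInterval) :
    iidProb (twoPoint loop base t) G = (t : ℝ) ^ k := by
  rw [twoPoint, iidProb_map, ← iidProb_coin_forall]
  exact congrArg _ (Set.ext hG.loop_mem_iff)

lemma iidProb_hub (hG : IsAnchored G loop base hub) (t : unitInterval) :
    iidProb (twoPoint hub base t) G = 1 - (1 - (t : ℝ)) ^ k := by
  rw [twoPoint, iidProb_map, ← iidProb_coin_exists]
  exact congrArg _ (Set.ext hG.hub_mem_iff)

lemma not_forall_iidProb_eq_of_const_notMem {r : ℕ} {G : Set (Fin (r + 1) → V)}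
    (hG : IsAnchored G loop base hub) {E : Set (Fin r → V)} (hbase : (fun _ => base) ∉ E) :
    ¬ ∀ p₁ p₂ : PMF V, iidProb p₁ E = iidProb p₂ E → iidProb p₁ G = iidProb p₂ G := by
  intro determines
  have hloop : (fun _ => loop) ∈ E := by
    by_contra hloop
    simpa [hG.iidProb_loop] using determines (twoPoint loop base 0) (twoPoint loop base 1)
      (by simp [twoPoint_zero, twoPoint_one, iidProb_pure, hbase, hloop])
  have hhub : (fun _ => hub) ∈ E := by
    by_contra hhub
    simpa [hG.iidProb_hub] using determines (twoPoint hub base 0) (twoPoint hub base 1)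
      (by simp [twoPoint_zero, twoPoint_one, iidProb_pure, hbase, hhub])
  obtain ⟨α, hα⟩ : ∃ α : unitInterval, (α : ℝ) = 1 / (r + 1) :=
    ⟨⟨1 / (r + 1), by positivity, by rw [div_le_one] <;> linarith [r.cast_nonneg (α := ℝ)]⟩, rfl⟩
  have hα0 : (0 : ℝ) < α := by rw [hα]; positivity
  obtain ⟨γ, hγ⟩ : ∃ γ, iidProb (twoPoint hub base γ) E = iidProb (twoPoint loop base α) E :=
    mem_range_of_exists_le_of_exists_ge continuous_iidProb_twoPoint
      ⟨0, by simp [twoPoint_zero, iidProb_pure, hbase, iidProb_nonneg]⟩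
      ⟨1, by simp [twoPoint_one, iidProb_pure, hhub, iidProb_le_one]⟩
  have eq_pow : 1 - (1 - (γ : ℝ)) ^ (r + 1) = α ^ (r + 1) := by
    rw [← hG.iidProb_hub, ← hG.iidProb_loop]
    exact determines _ _ hγ
  have gamma_le : (γ : ℝ) ≤ α ^ (r + 1) := by
    have := pow_le_of_le_one (sub_nonneg.2 γ.2.2) (sub_le_self 1 γ.2.1) (Nat.add_one_ne_zero r)
    linarith
  have : (α : ℝ) ^ r < α ^ r :=
    calc (α : ℝ) ^ r ≤ iidProb (twoPoint loop base α) E := pow_le_iidProb_twoPoint hloop α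
      _ = iidProb (twoPoint hub base γ) E := hγ.symm
      _ ≤ r * γ := iidProb_twoPoint_le hbase γ
      _ ≤ r * α ^ (r + 1) := by gcongr
      _ = r / (r + 1) * α ^ r := by rw [pow_succ, hα]; ring
      _ < α ^ r := mul_lt_of_lt_one_left (by positivity) (by rw [div_lt_one] <;> linarith)
  exact this.false

lemma exists_iidProb_eq_and_iidProb_ne {r : ℕ} {G : Set (Fin (r + 1) → V)}
    (hG : IsAnchored G loop base hub) (E : Set (Fin r → V)) :
    ∃ p₁ p₂ : PMF V, iidProb p₁ E = iidProb p₂ E ∧ iidProb p₁ G ≠ iidProb p₂ G := by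
  by_contra! determines
  by_cases hbase : (fun _ => base) ∈ E
  · refine hG.not_forall_iidProb_eq_of_const_notMem (E := Eᶜ) (by simpa using hbase) ?_
    simpa only [iidProb_compl, sub_right_inj] using determines
  · exact hG.not_forall_iidProb_eq_of_const_notMem hbase determines

lemma le_one_of_mul_ipm_le {k' : ℕ} {g : KHypergraph V k} [NeZero k]
    (hg : IsAnchored g.edges loop base hub) {ε : ℝ} {ℋ : Set (KHypergraph V k')}
    (H : ∀ p₁ p₂ : PMF V, ε * ipm {g} p₁ p₂ ≤ ipm ℋ p₁ p₂) : ε ≤ 1 := by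
  have h := H (twoPoint loop base 1) (twoPoint loop base 0)
  rw [ipm_singleton, edgeFreq, edgeFreq, hg.iidProb_loop, hg.iidProb_loop] at h
  simpa [NeZero.ne k] using h.trans (ipm_le_one ℋ _ _)

end IsAnchored

end Anchors

section Links

variable {V : Type*} [Fintype V] {k : ℕ}

namespace KHypergraph

open Classical in
/-- The link of the tuple `u` in the hypergraph `h`: the set of vertices that complete `u` to an
edge. -/
noncomputable def link (h : KHypergraph V (k + 1)) (u : Fin k → V) : Finset V :=
  Finset.univ.filter fun v => (Fin.cons v u : Fin (k + 1) → V) ∈ h.edges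

lemma mem_link {h : KHypergraph V (k + 1)} {u : Fin k → V} {v : V} :
    v ∈ h.link u ↔ (Fin.cons v u : Fin (k + 1) → V) ∈ h.edges := by
  simp [link]

lemma mem_edges_proj {h : KHypergraph V (k + 1)} {u : Fin k → V} {v : V} :
    u ∈ (h.proj v).edges ↔ v ∈ h.link u :=
  mem_link.symm

lemma link_proj (h : KHypergraph V (k + 2)) (u : Fin k → V) (x : V) :
    (h.proj x).link u = h.link (Fin.cons x u) := by
  have swap_entries (y z : V) : (Fin.cons y (Fin.cons z u : Fin (k + 1) → V) : Fin (k + 2) → V) ∘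
      Equiv.swap 0 1 = Fin.cons z (Fin.cons y u : Fin (k + 1) → V) := by
    funext i
    refine Fin.cases ?_ (fun j => Fin.cases ?_ (fun l => ?_) j) i
    · simp
    · simp
    · have hl : l.succ.succ ≠ 1 := fun h => Fin.succ_ne_zero l (Fin.succ_injective _ h)
      simp [Equiv.swap_apply_of_ne_of_ne (Fin.succ_ne_zero _) hl]
  ext v
  simp only [mem_link]
  constructor <;> intro hv
  · exact swap_entries x v ▸ h.undirected (Equiv.swap 0 1) _ hv
  · change Fin.cons x (Fin.cons v u : Fin (k + 1) → V) ∈ h.edges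
    exact swap_entries v x ▸ h.undirected (Equiv.swap 0 1) _ hv

lemma ext_link {h h' : KHypergraph V (k + 1)} (H : ∀ u, h.link u = h'.link u) : h = h' := by
  ext v
  rw [← Fin.cons_self_tail v, ← mem_link, ← mem_link, H]

end KHypergraph

open Classical in
/-- The set system of the links of the tuple `u` in the members of `ℋ`. -/
noncomputable def linkFamily (ℋ : Set (KHypergraph V (k + 1))) (u : Fin k → V) :
    Finset (Finset V) :=
  Finset.univ.filter fun D => ∃ h ∈ ℋ, h.link u = D

lemma mem_linkFamily {ℋ : Set (KHypergraph V (k + 1))} {u : Fin k → V} {D : Finset V} :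
    D ∈ linkFamily ℋ u ↔ ∃ h ∈ ℋ, h.link u = D := by
  simp [linkFamily]

lemma linkFamily_cons (ℋ : Set (KHypergraph V (k + 2))) (x : V) (u : Fin k → V) :
    linkFamily ℋ (Fin.cons x u) = linkFamily ((fun h => h.proj x) '' ℋ) u := by
  ext D
  simp [mem_linkFamily, KHypergraph.link_proj]

open Classical in
lemma vcDim_linkFamily_le_gVC (ℋ : Set (KHypergraph V (k + 1))) (u : Fin k → V) :
    (linkFamily ℋ u).vcDim ≤ gVC (k + 1) ℋ := by
  induction k with
  | zero =>
    have constant (v : V) : (Fin.cons v u : Fin 1 → V) = fun _ => v := by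
      funext i
      rw [Fin.fin_one_eq_zero i, Fin.cons_zero]
    refine le_of_eq (congrArg Finset.vcDim ?_)
    ext D
    simp [mem_linkFamily, Finset.ext_iff, KHypergraph.mem_link, constant, iff_comm]
  | succ k ih =>
    rw [← Fin.cons_self_tail u, linkFamily_cons, gVC]
    exact (ih _ _).trans (Finset.le_sup
      (f := fun v : V => gVC (k + 1) ((fun g => g.proj v) '' ℋ)) (Finset.mem_univ (u 0)))

lemma subsingleton_of_gVC_eq_zero {ℋ : Set (KHypergraph V (k + 1))} (hℋ : gVC (k + 1) ℋ = 0) :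
    ℋ.Subsingleton := by
  classical
  have link_subset : ∀ h ∈ ℋ, ∀ h' ∈ ℋ, ∀ u, h.link u ⊆ h'.link u := by
    intro h hh h' hh' u v hv
    by_contra hv'
    have shatters : (linkFamily ℋ u).Shatters {v} := by
      intro t ht
      rcases Finset.subset_singleton_iff.1 ht with rfl | rfl
      · exact ⟨_, mem_linkFamily.2 ⟨h', hh', rfl⟩, by simp [hv']⟩
      · exact ⟨_, mem_linkFamily.2 ⟨h, hh, rfl⟩, by simp [hv]⟩
    have hcard := shatters.card_le_vcDim.trans (vcDim_linkFamily_le_gVC ℋ u)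
    simp [hℋ] at hcard
  exact fun h hh h' hh' => KHypergraph.ext_link fun u =>
    (link_subset h hh h' hh' u).antisymm (link_subset h' hh' h hh u)

end Links

lemma IsAnchored.one_le_gVC {V : Type*} [Fintype V] {r : ℕ} {g : KHypergraph V (r + 2)}
    {loop base hub : V} (hg : IsAnchored g.edges loop base hub) {ε : ℝ} (hε : 0 < ε)
    {ℋ : Set (KHypergraph V (r + 1))}
    (H : ∀ p₁ p₂ : PMF V, ε * ipm {g} p₁ p₂ ≤ ipm ℋ p₁ p₂) : 1 ≤ gVC (r + 1) ℋ := by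
  by_contra! hgVC
  have separates (E : Set (Fin (r + 1) → V)) :
      ∃ p₁ p₂ : PMF V, iidProb p₁ E = iidProb p₂ E ∧ 0 < ipm ℋ p₁ p₂ := by
    obtain ⟨p₁, p₂, hE, hG⟩ := hg.exists_iidProb_eq_and_iidProb_ne E
    refine ⟨p₁, p₂, hE, (mul_pos hε ?_).trans_le (H p₁ p₂)⟩
    rw [ipm_singleton]
    exact abs_pos.2 (sub_ne_zero.2 hG)
  have hsub : ℋ.Subsingleton := subsingleton_of_gVC_eq_zero (Nat.lt_one_iff.1 hgVC)
  rcases hsub.eq_empty_or_singleton with rfl | ⟨h, rfl⟩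
  · obtain ⟨p₁, p₂, -, hpos⟩ := separates ∅
    exact hpos.not_ge (ipm_le le_rfl (by simp))
  · obtain ⟨p₁, p₂, hE, hpos⟩ := separates h.edges
    simp [ipm_singleton, edgeFreq, hE] at hpos

section HybridArgument

variable {V : Type*} [Fintype V] {k : ℕ}

lemma edgeFreq_eq_sum_mul_edgeFreq_proj (P : PMF V) (h : KHypergraph V (k + 1)) :
    edgeFreq P h = ∑ v, (P v).toReal * edgeFreq P (h.proj v) := by
  classical
  rw [edgeFreq, iidProb, ← (Fin.consEquiv fun _ : Fin (k + 1) => V).sum_comp,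
    Fintype.sum_prod_type]
  refine Finset.sum_congr rfl fun v _ => ?_
  simp [edgeFreq, iidProb, Finset.mul_sum, Fin.consEquiv, Fin.prod_univ_succ,
    KHypergraph.mem_edges_proj, KHypergraph.mem_link]

lemma sum_mul_edgeFreq_proj (f : V → ℝ) (P : PMF V) (h : KHypergraph V (k + 1)) :
    ∑ v, f v * edgeFreq P (h.proj v) =
      ∑ u : Fin k → V, (∏ i, (P (u i)).toReal) * ∑ v ∈ h.link u, f v := by
  classical
  simp only [edgeFreq, iidProb, KHypergraph.mem_edges_proj, Finset.mul_sum, mul_ite, mul_zero]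
  rw [Finset.sum_comm]
  refine Finset.sum_congr rfl fun u _ => ?_
  simp [mul_comm]

lemma abs_sum_mul_le_of_support {ι : Type*} [Fintype ι] {w a : ι → ℝ} (hw : ∀ i, 0 ≤ w i)
    (hw1 : ∑ i, w i = 1) {B : ℝ} (ha : ∀ i, w i ≠ 0 → |a i| ≤ B) : |∑ i, w i * a i| ≤ B :=
  calc |∑ i, w i * a i| ≤ ∑ i, |w i * a i| := Finset.abs_sum_le_sum_abs _ _
    _ ≤ ∑ i, w i * B := by
        refine Finset.sum_le_sum fun i _ => ?_
        rw [abs_mul, abs_of_nonneg (hw i)]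
        rcases eq_or_ne (w i) 0 with hi | hi
        · simp [hi]
        · exact mul_le_mul_of_nonneg_left (ha i hi) (hw i)
    _ = B := by rw [← Finset.sum_mul, hw1, one_mul]

lemma abs_sum_sub_mul_edgeFreq_proj_le {P₁ P₂ : PMF V} {B : ℝ} {h : KHypergraph V (k + 1)}
    (hB : ∀ u : Fin k → V, (∀ i, u i ∈ P₁.support ∪ P₂.support) →
      |∑ v ∈ h.link u, ((P₁ v).toReal - (P₂ v).toReal)| ≤ B) :
    |∑ v, ((P₁ v).toReal - (P₂ v).toReal) * edgeFreq P₂ (h.proj v)| ≤ B := by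
  rw [sum_mul_edgeFreq_proj]
  refine abs_sum_mul_le_of_support (fun u => by positivity) (sum_prod_toReal_pmf P₂)
    fun u hu => hB u fun i => Or.inr ?_
  exact fun hi => Finset.prod_ne_zero_iff.1 hu i (Finset.mem_univ i) (by simp [hi])

lemma abs_edgeFreq_sub_le_add {P₁ P₂ : PMF V} {B B' : ℝ} {h : KHypergraph V (k + 1)}
    (hB : ∀ u : Fin k → V, (∀ i, u i ∈ P₁.support ∪ P₂.support) →
      |∑ v ∈ h.link u, ((P₁ v).toReal - (P₂ v).toReal)| ≤ B)
    (hB' : ∀ v ∈ P₁.support, |edgeFreq P₁ (h.proj v) - edgeFreq P₂ (h.proj v)| ≤ B') :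
    |edgeFreq P₁ h - edgeFreq P₂ h| ≤ B + B' := by
  have replace_first : edgeFreq P₁ h - edgeFreq P₂ h =
      ∑ v, ((P₁ v).toReal - (P₂ v).toReal) * edgeFreq P₂ (h.proj v) +
        ∑ v, (P₁ v).toReal * (edgeFreq P₁ (h.proj v) - edgeFreq P₂ (h.proj v)) := by
    rw [edgeFreq_eq_sum_mul_edgeFreq_proj, edgeFreq_eq_sum_mul_edgeFreq_proj P₂,
      ← Finset.sum_sub_distrib, ← Finset.sum_add_distrib]
    exact Finset.sum_congr rfl fun v _ => by ring
  rw [replace_first]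
  refine (abs_add_le _ _).trans (add_le_add (abs_sum_sub_mul_edgeFreq_proj_le hB) ?_)
  refine abs_sum_mul_le_of_support (fun _ => by positivity) (sum_toReal_pmf P₁) fun v hv => ?_
  exact hB' v fun h0 => hv (by simp [h0])

lemma abs_edgeFreq_sub_le {P₁ P₂ : PMF V} {B : ℝ} {h : KHypergraph V (k + 1)}
    (hB : ∀ u : Fin k → V, (∀ i, u i ∈ P₁.support ∪ P₂.support) →
      |∑ v ∈ h.link u, ((P₁ v).toReal - (P₂ v).toReal)| ≤ B) :
    |edgeFreq P₁ h - edgeFreq P₂ h| ≤ (k + 1) * B := by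
  induction k with
  | zero =>
    simpa using abs_edgeFreq_sub_le_add hB (B' := 0) fun v _ => by simp [edgeFreq, iidProb]
  | succ k ih =>
    have link_le (v : V) (hv : v ∈ P₁.support) (u : Fin k → V)
        (hu : ∀ i, u i ∈ P₁.support ∪ P₂.support) :
        |∑ x ∈ (h.proj v).link u, ((P₁ x).toReal - (P₂ x).toReal)| ≤ B := by
      rw [KHypergraph.link_proj]
      exact hB _ (Fin.cases (Or.inl hv) hu)
    calc |edgeFreq P₁ h - edgeFreq P₂ h| ≤ B + (k + 1) * B :=
          abs_edgeFreq_sub_le_add hB fun v hv => ih (link_le v hv)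
      _ = ((k + 1 : ℕ) + 1) * B := by push_cast; ring

end HybridArgument

section SauerShelah

lemma sum_Iic_choose_le_pow (N d : ℕ) : ∑ i ∈ Finset.Iic d, N.choose i ≤ (N + 1) ^ d := by
  rw [← Nat.range_succ_eq_Iic]
  induction d with
  | zero => simp
  | succ d ih =>
    calc ∑ i ∈ Finset.range (d + 1 + 1), N.choose i
        = ∑ i ∈ Finset.range (d + 1), N.choose i + N.choose (d + 1) := Finset.sum_range_succ _ _
      _ ≤ (N + 1) ^ d + N ^ d * N := by
        rw [← pow_succ]
        exact add_le_add ih (Nat.choose_le_pow _ _)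
      _ ≤ (N + 1) ^ d + (N + 1) ^ d * N := by gcongr; exact Nat.le_succ N
      _ = (N + 1) ^ (d + 1) := by ring

variable {V Y : Type*} [DecidableEq V] [DecidableEq Y] [Fintype Y]

/-- The traces of the members of `𝒜` along the embedding `ψ`, as sets of points of `Y`. -/
def traces (𝒜 : Finset (Finset V)) (ψ : Y ↪ V) : Finset (Finset Y) :=
  𝒜.image fun D => Finset.univ.filter fun y => ψ y ∈ D

lemma shatters_map_of_shatters_traces {𝒜 : Finset (Finset V)} {ψ : Y ↪ V} {s : Finset Y}
    (hs : (traces 𝒜 ψ).Shatters s) : 𝒜.Shatters (s.map ψ) := by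
  intro t ht
  obtain ⟨t, rfl⟩ : ∃ t', t = t'.map ψ :=
    (Finset.subset_map_iff.1 ht).imp fun _ h => h.2
  obtain ⟨b, hb, hbt⟩ := hs (Finset.map_subset_map.1 ht)
  obtain ⟨D, hD, rfl⟩ := Finset.mem_image.1 hb
  refine ⟨D, hD, ?_⟩
  ext v
  simp only [← hbt, Finset.mem_inter, Finset.mem_map, Finset.mem_filter, Finset.mem_univ, true_and]
  grind

lemma vcDim_traces_le (𝒜 : Finset (Finset V)) (ψ : Y ↪ V) : (traces 𝒜 ψ).vcDim ≤ 𝒜.vcDim :=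
  Finset.sup_le fun s hs => by
    simpa using (shatters_map_of_shatters_traces (Finset.mem_shatterer.1 hs)).card_le_vcDim

lemma card_traces_le (𝒜 : Finset (Finset V)) (ψ : Y ↪ V) :
    (traces 𝒜 ψ).card ≤ (Fintype.card Y + 1) ^ 𝒜.vcDim :=
  calc (traces 𝒜 ψ).card ≤ (traces 𝒜 ψ).shatterer.card := Finset.card_le_card_shatterer _
    _ ≤ ∑ i ∈ Finset.Iic (traces 𝒜 ψ).vcDim, (Fintype.card Y).choose i :=
      Finset.card_shatterer_le_sum_vcDim
    _ ≤ (Fintype.card Y + 1) ^ (traces 𝒜 ψ).vcDim := sum_Iic_choose_le_pow _ _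
    _ ≤ (Fintype.card Y + 1) ^ 𝒜.vcDim :=
      Nat.pow_le_pow_right (Nat.succ_pos _) (vcDim_traces_le 𝒜 ψ)

end SauerShelah

section Hoeffding

variable {κ : Type*} [Fintype κ] [DecidableEq κ] {f : κ → Bool → ℝ}

lemma sum_exp_mul_sum_le (hneg : ∀ y, f y false = -f y true) (hf : ∀ y, |f y true| ≤ 1) (l : ℝ) :
    ∑ σ : κ → Bool, Real.exp (l * ∑ y, f y (σ y)) ≤
      2 ^ Fintype.card κ * Real.exp (l ^ 2 * Fintype.card κ / 2) := by
  calc ∑ σ : κ → Bool, Real.exp (l * ∑ y, f y (σ y))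
      = ∏ y, ∑ b, Real.exp (l * f y b) := by
        simp only [Finset.mul_sum, Real.exp_sum, Fintype.prod_sum]
    _ = ∏ y, 2 * Real.cosh (l * f y true) := by
        refine Finset.prod_congr rfl fun y _ => ?_
        rw [Fintype.sum_bool, hneg, Real.cosh_eq, mul_neg]
        ring
    _ ≤ ∏ _y : κ, 2 * Real.exp (l ^ 2 / 2) := by
        gcongr with y
        refine (Real.cosh_le_exp_half_sq _).trans (Real.exp_le_exp.2 ?_)
        rw [mul_pow]
        refine div_le_div_of_nonneg_right ?_ zero_le_two
        exact mul_le_of_le_one_right (sq_nonneg l) ((sq_le_one_iff_abs_le_one _).2 (hf y))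
    _ = 2 ^ Fintype.card κ * Real.exp (l ^ 2 * Fintype.card κ / 2) := by
        rw [Finset.prod_const, mul_pow, Finset.card_univ, ← Real.exp_nat_mul]
        congr 2
        ring

lemma card_lt_abs_sum_le (hneg : ∀ y, f y false = -f y true) (hf : ∀ y, |f y true| ≤ 1) {η : ℝ}
    (hη : 0 ≤ η) :
    ((Finset.univ.filter fun σ : κ → Bool =>
        η * Fintype.card κ < |∑ y, f y (σ y)|).card : ℝ) ≤
      2 ^ Fintype.card κ * (2 * Real.exp (-(η ^ 2 * Fintype.card κ / 2))) := by
  set m : ℝ := (Fintype.card κ : ℝ)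
  have indicator_le (S : ℝ) : (if η * m < |S| then (1 : ℝ) else 0) ≤
      Real.exp (-(η ^ 2 * m)) * (Real.exp (η * S) + Real.exp (-η * S)) := by
    split_ifs with hS
    · rw [mul_add, ← Real.exp_add, ← Real.exp_add]
      rcases lt_abs.1 hS with hS | hS
      · exact le_add_of_le_of_nonneg (Real.one_le_exp (by nlinarith)) (Real.exp_pos _).le
      · exact le_add_of_nonneg_of_le (Real.exp_pos _).le (Real.one_le_exp (by nlinarith))
    · positivity
  calc ((Finset.univ.filter fun σ : κ → Bool => η * m < |∑ y, f y (σ y)|).card : ℝ)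
      = ∑ σ : κ → Bool, if η * m < |∑ y, f y (σ y)| then (1 : ℝ) else 0 := by simp
    _ ≤ Real.exp (-(η ^ 2 * m)) * ∑ σ : κ → Bool,
          (Real.exp (η * ∑ y, f y (σ y)) + Real.exp (-η * ∑ y, f y (σ y))) := by
        rw [Finset.mul_sum]
        exact Finset.sum_le_sum fun σ _ => indicator_le _
    _ ≤ Real.exp (-(η ^ 2 * m)) * (2 ^ Fintype.card κ * Real.exp (η ^ 2 * m / 2) +
          2 ^ Fintype.card κ * Real.exp ((-η) ^ 2 * m / 2)) := by
        rw [Finset.sum_add_distrib]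
        gcongr <;> exact sum_exp_mul_sum_le hneg hf _
    _ = 2 ^ Fintype.card κ * (2 * (Real.exp (-(η ^ 2 * m)) * Real.exp (η ^ 2 * m / 2))) := by
        rw [neg_sq]
        ring
    _ = 2 ^ Fintype.card κ * (2 * Real.exp (-(η ^ 2 * m / 2))) := by
        rw [← Real.exp_add]
        congr 3
        ring

end Hoeffding

section SecretSharing

/-- A threshold scheme in which every dealing `t : T` hands out shares, valued in `F` and indexed by
`ι`, of a secret valued in `S`. Any `r + 1` shares determine the secret, and any `r` shares say
nothing about it: permutations of the dealings that preserve these shares move the secret of each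
dealing through every value exactly once. -/
structure ThresholdScheme (T ι F S : Type*) (r : ℕ) where
  share : T → ι → F
  secret : T → S
  secret_eq : ∀ (J : Finset ι), r + 1 ≤ J.card → ∀ t t',
    (∀ j ∈ J, share t j = share t' j) → secret t = secret t'
  privacy : ∀ (J : Finset ι), J.card ≤ r → ∃ σ : S → Equiv.Perm T,
    (∀ t, Function.Bijective fun s => secret (σ s t)) ∧
      ∀ s t, ∀ j ∈ J, share (σ s t) j = share t j

open Polynomial in
lemma exists_degreeLT_eval_zero_eq_one {F ι : Type*} [Field F] (x : ι → Fˣ) {r : ℕ} {J : Finset ι}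
    (hJ : J.card ≤ r) :
    ∃ w : degreeLT F (r + 1), (w : F[X]).eval 0 = 1 ∧ ∀ j ∈ J, (w : F[X]).eval (x j : F) = 0 := by
  have hlinear (j : ι) : (1 - C (x j : F)⁻¹ * X).degree ≤ 1 :=
    (degree_sub_le _ _).trans (max_le (degree_one_le.trans zero_le_one) (degree_C_mul_X_le _))
  have hdeg : (∏ j ∈ J, (1 - C (x j : F)⁻¹ * X)).degree < ((r + 1 : ℕ) : WithBot ℕ) :=
    calc (∏ j ∈ J, (1 - C (x j : F)⁻¹ * X)).degree
        ≤ ∑ j ∈ J, (1 - C (x j : F)⁻¹ * X).degree := degree_prod_le _ _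
      _ ≤ ∑ _j ∈ J, (1 : WithBot ℕ) := by gcongr with j; exact hlinear j
      _ = (J.card : WithBot ℕ) := by rw [Finset.sum_const, nsmul_one]
      _ < ((r + 1 : ℕ) : WithBot ℕ) := by exact_mod_cast Nat.lt_succ_of_le hJ
  refine ⟨⟨_, mem_degreeLT.2 hdeg⟩, ?_, fun j hj => ?_⟩
  · simp [eval_prod]
  · rw [eval_prod]
    exact Finset.prod_eq_zero hj (by simp)

open Polynomial in
/-- Shamir's scheme: a dealing is a polynomial of degree at most `r`, the shares are its values at
the points `x j ≠ 0`, and the secret is its value at `0`, recoded by `bits`. -/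
noncomputable def shamirScheme {F ι S : Type*} [Field F] (x : ι ↪ Fˣ) (bits : F ≃ S) (r : ℕ) :
    ThresholdScheme (degreeLT F (r + 1)) ι F S r where
  share t j := (t : F[X]).eval (x j : F)
  secret t := bits ((t : F[X]).eval 0)
  secret_eq J hJ t t' h := by
    have hinj : Set.InjOn (fun j => (x j : F)) (J : Set ι) := fun i _ j _ hij =>
      x.injective (Units.ext hij)
    have hdeg (t : degreeLT F (r + 1)) : (t : F[X]).degree < J.card :=
      (mem_degreeLT.1 t.2).trans_le (mod_cast hJ)
    rw [eq_of_degrees_lt_of_eval_index_eq J hinj (hdeg t) (hdeg t') h]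
  privacy J hJ := by
    obtain ⟨w, hw0, hwJ⟩ := exists_degreeLT_eval_zero_eq_one x hJ
    refine ⟨fun s => Equiv.addRight (bits.symm s • w), fun t => ?_, fun s t j hj => ?_⟩
    · have hsecret : (fun s => bits (((Equiv.addRight (bits.symm s • w) t :
          degreeLT F (r + 1)) : F[X]).eval 0)) =
          bits.symm.trans ((Equiv.addLeft ((t : F[X]).eval 0)).trans bits) := by
        funext s
        simp [hw0]
      exact hsecret ▸ Equiv.bijective _
    · simp [hwJ j hj]

variable {T ι F S : Type*} {r : ℕ} [Fintype S] [Nonempty S]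

open Classical in
lemma ThresholdScheme.card_filter_secret_le [Fintype T] (A : ThresholdScheme T ι F S r)
    {J : Finset ι} (hJ : J.card ≤ r) {R : T → S → Prop}
    (hR : ∀ t t', (∀ j ∈ J, A.share t j = A.share t' j) → R t = R t') {β : ℝ}
    (hβ : ∀ t, ((Finset.univ.filter (R t)).card : ℝ) ≤ Fintype.card S * β) :
    ((Finset.univ.filter fun t => R t (A.secret t)).card : ℝ) ≤ Fintype.card T * β := by
  obtain ⟨σ, hbij, hshare⟩ := A.privacy J hJ
  have shifted (s : S) : (Finset.univ.filter fun t => R t (A.secret (σ s t))).card =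
      (Finset.univ.filter fun t => R t (A.secret t)).card :=
    Finset.card_equiv (σ s) fun t => by simp [hR _ _ (hshare s t)]
  have resampled (t : T) : (Finset.univ.filter fun s => R t (A.secret (σ s t))).card =
      (Finset.univ.filter (R t)).card :=
    Finset.card_equiv (Equiv.ofBijective _ (hbij t)) fun s => by simp
  refine le_of_mul_le_mul_left ?_ (mod_cast Fintype.card_pos : (0 : ℝ) < Fintype.card S)
  calc (Fintype.card S : ℝ) * (Finset.univ.filter fun t => R t (A.secret t)).card
      = ∑ s, ((Finset.univ.filter fun t => R t (A.secret (σ s t))).card : ℝ) := by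
        simp only [shifted, Finset.sum_const, Finset.card_univ, nsmul_eq_mul]
    _ = ∑ t, ((Finset.univ.filter fun s => R t (A.secret (σ s t))).card : ℝ) := by
        simp only [Finset.card_filter, Nat.cast_sum]
        exact Finset.sum_comm
    _ ≤ ∑ _t : T, Fintype.card S * β :=
        Finset.sum_le_sum fun t _ => by simpa only [resampled] using hβ t
    _ = Fintype.card S * (Fintype.card T * β) := by
        rw [Finset.sum_const, Finset.card_univ, nsmul_eq_mul]
        ring

open Classical in
lemma ThresholdScheme.exists_forall_not_secret {I : Type*} [Fintype I] [Finite T] [Nonempty T]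
    (A : ThresholdScheme T ι F S r) (J : I → Finset ι) (hJ : ∀ i, (J i).card ≤ r)
    {R : I → T → S → Prop}
    (hR : ∀ i t t', (∀ j ∈ J i, A.share t j = A.share t' j) → R i t = R i t') {β : ℝ}
    (hβ : ∀ i t, ((Finset.univ.filter (R i t)).card : ℝ) ≤ Fintype.card S * β)
    (hsmall : Fintype.card I * β < 1) : ∃ t, ∀ i, ¬ R i t (A.secret t) := by
  by_contra! hbad
  have := Fintype.ofFinite T
  have hcover : Finset.univ ⊆ Finset.univ.biUnion fun i =>
      Finset.univ.filter fun t => R i t (A.secret t) := fun t _ => by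
    simpa using hbad t
  have hle : (Fintype.card T : ℝ) ≤ Fintype.card T * (Fintype.card I * β) :=
    calc (Fintype.card T : ℝ)
        ≤ ∑ i, ((Finset.univ.filter fun t => R i t (A.secret t)).card : ℝ) :=
          mod_cast (Finset.card_le_card hcover).trans Finset.card_biUnion_le
      _ ≤ ∑ _i : I, Fintype.card T * β :=
          Finset.sum_le_sum fun i _ => A.card_filter_secret_le (hJ i) (hR i) (hβ i)
      _ = Fintype.card T * (Fintype.card I * β) := by
          rw [Finset.sum_const, Finset.card_univ, nsmul_eq_mul]
          ring
  have hT : (0 : ℝ) < Fintype.card T := mod_cast Fintype.card_pos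
  exact hle.not_gt (mul_lt_of_lt_one_right hT hsmall)

end SecretSharing

section Correlation

variable {κ : Type*} [Fintype κ] [DecidableEq κ]

/-- How much better the bits `σ` fit the set `D` of bit assignments than the complementary bits. -/
def correlation (D : Finset (κ × Bool)) (σ : κ → Bool) : ℝ :=
  ∑ y, ((if (y, σ y) ∈ D then 1 else 0) - if (y, !σ y) ∈ D then 1 else 0)

open Classical in
lemma card_filter_exists_lt_correlation_le (𝒟 : Finset (Finset (κ × Bool))) {η : ℝ} (hη : 0 ≤ η) :
    ((Finset.univ.filter fun σ : κ → Bool =>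
        ∃ D ∈ 𝒟, η * Fintype.card κ < |correlation D σ|).card : ℝ) ≤
      𝒟.card * (2 ^ Fintype.card κ * (2 * Real.exp (-(η ^ 2 * Fintype.card κ / 2)))) := by
  have single_le (D : Finset (κ × Bool)) : ((Finset.univ.filter fun σ : κ → Bool =>
      η * Fintype.card κ < |correlation D σ|).card : ℝ) ≤
      2 ^ Fintype.card κ * (2 * Real.exp (-(η ^ 2 * Fintype.card κ / 2))) := by
    convert card_lt_abs_sum_le (κ := κ) (f := fun y b =>
      (if (y, b) ∈ D then 1 else 0) - if (y, !b) ∈ D then 1 else 0)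
      (fun y => by simp) (fun y => by split_ifs <;> simp) hη
    rfl
  calc ((Finset.univ.filter fun σ : κ → Bool =>
        ∃ D ∈ 𝒟, η * Fintype.card κ < |correlation D σ|).card : ℝ)
      ≤ ∑ D ∈ 𝒟, ((Finset.univ.filter fun σ : κ → Bool =>
          η * Fintype.card κ < |correlation D σ|).card : ℝ) := by
        have : (Finset.univ.filter fun σ : κ → Bool =>
            ∃ D ∈ 𝒟, η * Fintype.card κ < |correlation D σ|) =
            𝒟.biUnion fun D => Finset.univ.filter fun σ =>
              η * Fintype.card κ < |correlation D σ| := by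
          ext
          simp
        rw [this]
        exact_mod_cast Finset.card_biUnion_le
    _ ≤ _ := by
        rw [← nsmul_eq_mul]
        exact Finset.sum_le_card_nsmul _ _ _ fun D _ => single_le D

lemma ThresholdScheme.exists_forall_abs_correlation_le {T ι F I : Type*} {r : ℕ} [Finite T]
    [Nonempty T] [Fintype I] (A : ThresholdScheme T ι F (κ → Bool) r)
    (J : I → Finset ι) (hJ : ∀ i, (J i).card ≤ r) (𝒟 : I → T → Finset (Finset (κ × Bool)))
    (h𝒟 : ∀ i t t', (∀ j ∈ J i, A.share t j = A.share t' j) → 𝒟 i t = 𝒟 i t')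
    {M : ℝ} (hM : ∀ i t, ((𝒟 i t).card : ℝ) ≤ M) {η : ℝ} (hη : 0 ≤ η)
    (hsmall : Fintype.card I * (M * (2 * Real.exp (-(η ^ 2 * Fintype.card κ / 2)))) < 1) :
    ∃ t, ∀ i, ∀ D ∈ 𝒟 i t, |correlation D (A.secret t)| ≤ η * Fintype.card κ := by
  classical
  have correlated_le (i : I) (t : T) : ((Finset.univ.filter fun σ : κ → Bool =>
      ∃ D ∈ 𝒟 i t, η * Fintype.card κ < |correlation D σ|).card : ℝ) ≤
      Fintype.card (κ → Bool) * (M * (2 * Real.exp (-(η ^ 2 * Fintype.card κ / 2)))) :=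
    calc _ ≤ ((𝒟 i t).card : ℝ) *
          (2 ^ Fintype.card κ * (2 * Real.exp (-(η ^ 2 * Fintype.card κ / 2)))) := by
          convert card_filter_exists_lt_correlation_le (𝒟 i t) hη
      _ ≤ M * (2 ^ Fintype.card κ * (2 * Real.exp (-(η ^ 2 * Fintype.card κ / 2)))) :=
          mul_le_mul_of_nonneg_right (hM i t) (by positivity)
      _ = Fintype.card (κ → Bool) *
            (M * (2 * Real.exp (-(η ^ 2 * Fintype.card κ / 2)))) := by
          simp only [Fintype.card_fun, Fintype.card_bool, Nat.cast_pow, Nat.cast_ofNat]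
          ring
  obtain ⟨t, ht⟩ := A.exists_forall_not_secret J hJ
    (R := fun i t σ => ∃ D ∈ 𝒟 i t, η * Fintype.card κ < |correlation D σ|)
    (fun i t t' h => by simp only [h𝒟 i t t' h])
    (fun i t => by convert correlated_le i t) hsmall
  exact ⟨t, by simpa using ht⟩

end Correlation

section Relabelling

variable {V W : Type*} {k : ℕ}

/-- The hypergraph `g` with its vertices relabelled along the embedding `e`. -/
def KHypergraph.map (g : KHypergraph W k) (e : W ↪ V) : KHypergraph V k where
  edges := (e ∘ ·) '' g.edges
  undirected π := by
    rintro _ ⟨w, hw, rfl⟩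
    exact ⟨w ∘ π, g.undirected π w hw, rfl⟩

lemma KHypergraph.comp_mem_edges_map {g : KHypergraph W k} {e : W ↪ V} {w : Fin k → W} :
    e ∘ w ∈ (g.map e).edges ↔ w ∈ g.edges :=
  e.injective.comp_left.mem_set_image

lemma IsAnchored.map {g : KHypergraph W k} {loop base hub : W}
    (hg : IsAnchored g.edges loop base hub) (e : W ↪ V) :
    IsAnchored (g.map e).edges (e loop) (e base) (e hub) where
  loop_mem_iff ω := by
    rw [← hg.loop_mem_iff, ← KHypergraph.comp_mem_edges_map (e := e)]
    simp only [Function.comp_def, Bool.apply_cond e]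
  hub_mem_iff ω := by
    rw [← hg.hub_mem_iff, ← KHypergraph.comp_mem_edges_map (e := e)]
    simp only [Function.comp_def, Bool.apply_cond e]

lemma edgeFreq_map [Fintype V] [Fintype W] (P : PMF W) (g : KHypergraph W k) (e : W ↪ V) :
    edgeFreq (P.map e) (g.map e) = edgeFreq P g := by
  rw [edgeFreq, iidProb_map]
  exact congrArg _ (Set.ext fun _ => KHypergraph.comp_mem_edges_map)

end Relabelling

/-- The vertices of the hypergraph built from a threshold scheme whose secret is a string of bits
indexed by `κ`: the possible values of each share, the possible values of each bit of the secret,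
and three vertices that serve as anchors. -/
inductive DealingVertex (ι F κ : Type*)
  | share (i : ι) (a : F)
  | bit (y : κ) (b : Bool)
  | loop
  | base
  | hub
  deriving Fintype

lemma card_dealingVertex (ι F κ : Type*) [Fintype ι] [Fintype F] [Fintype κ] :
    Fintype.card (DealingVertex ι F κ) =
      Fintype.card ι * Fintype.card F + 2 * Fintype.card κ + 3 := by
  rw [Fintype.card_congr (proxy_equiv% (DealingVertex ι F κ)).symm]
  simp
  ring

namespace ThresholdScheme

variable {T ι F κ : Type*} {r : ℕ}

/-- The tuples that consist of one bit of the secret of some dealing and of `r + 1` different shares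
of the same dealing, at any position of the bit. -/
def dealingEdges (A : ThresholdScheme T ι F (κ → Bool) r) :
    Set (Fin (r + 2) → DealingVertex ι F κ) :=
  {v | ∃ t i₀ y, v i₀ = .bit y (A.secret t y) ∧ ∃ J : Fin (r + 2) → ι, Set.InjOn J {i₀}ᶜ ∧
    ∀ i ≠ i₀, v i = .share (J i) (A.share t (J i))}

lemma comp_mem_dealingEdges {A : ThresholdScheme T ι F (κ → Bool) r} (π : Equiv.Perm (Fin (r + 2)))
    {v : Fin (r + 2) → DealingVertex ι F κ} (hv : v ∈ A.dealingEdges) :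
    v ∘ π ∈ A.dealingEdges := by
  obtain ⟨t, i₀, y, hbit, J, hJ, hshare⟩ := hv
  refine ⟨t, π.symm i₀, y, by simpa using hbit, J ∘ π, ?_, fun i hi => ?_⟩
  · exact hJ.comp π.injective.injOn fun i hi => by simpa [Equiv.eq_symm_apply] using hi
  · exact hshare (π i) fun h => hi (by simp [← h])

/-- The hypergraph with the dealing edges of `A`, to which the anchors are added. -/
def hypergraph (A : ThresholdScheme T ι F (κ → Bool) r) :
    KHypergraph (DealingVertex ι F κ) (r + 2) where
  edges := A.dealingEdges ∪ anchorEdges (r + 2) .loop .hub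
  undirected π _ := Or.imp (comp_mem_dealingEdges π) (comp_mem_anchorEdges π)

lemma isAnchored_hypergraph (A : ThresholdScheme T ι F (κ → Bool) r) :
    IsAnchored A.hypergraph.edges .loop .base .hub := by
  have anchors : IsAnchored (anchorEdges (r + 2) (.loop : DealingVertex ι F κ) .hub)
      .loop .base .hub := isAnchored_anchorEdges (by simp) (by simp) (by simp)
  have mem_iff {v : Fin (r + 2) → DealingVertex ι F κ} (hv : ∀ i y b, v i ≠ .bit y b) :
      v ∈ A.hypergraph.edges ↔ v ∈ anchorEdges (r + 2) .loop .hub :=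
    or_iff_right fun ⟨_, i₀, y, hbit, _⟩ => hv i₀ y _ hbit
  constructor <;> intro ω
  · rw [← anchors.loop_mem_iff, mem_iff fun i y b => by cases ω i <;> simp]
  · rw [← anchors.hub_mem_iff, mem_iff fun i y b => by cases ω i <;> simp]

/-- The vertices whose labels are consistent with the shares of the dealing `t`. -/
def vertexAt (A : ThresholdScheme T ι F (κ → Bool) r) (t : T) :
    ι ⊕ κ × Bool → DealingVertex ι F κ :=
  Sum.elim (fun i => .share i (A.share t i)) fun p => .bit p.1 p.2

lemma vertexAt_comp_eq {A : ThresholdScheme T ι F (κ → Bool) r} {t t' : T} {l : ℕ}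
    {u : Fin l → ι ⊕ κ × Bool} (h : ∀ i j, u i = .inl j → A.share t j = A.share t' j) :
    A.vertexAt t ∘ u = A.vertexAt t' ∘ u := by
  funext i
  rcases hi : u i with j | p
  · simp [vertexAt, hi, h i j hi]
  · simp [vertexAt, hi]

/-- The vertices that show the shares of the dealing `t` and the bits `τ`. -/
def showVertex (A : ThresholdScheme T ι F (κ → Bool) r) (t : T) (τ : κ → Bool) :
    ι ⊕ κ → DealingVertex ι F κ :=
  Sum.elim (fun i => .share i (A.share t i)) fun y => .bit y (τ y)

lemma showVertex_eq_vertexAt (A : ThresholdScheme T ι F (κ → Bool) r) (t : T) (τ : κ → Bool)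
    (ω : ι ⊕ κ) : A.showVertex t τ ω = A.vertexAt t (ω.map id fun y => (y, τ y)) := by
  cases ω <;> rfl

lemma showVertex_comp_notMem_edges (A : ThresholdScheme T ι F (κ → Bool) r) (t : T)
    (ω : Fin (r + 2) → ι ⊕ κ) :
    A.showVertex t (fun y => !A.secret t y) ∘ ω ∉ A.hypergraph.edges := by
  classical
  rintro (⟨t', i₀, y, hbit, J, hJ, hshare⟩ | hanchor)
  · have share_eq (i : Fin (r + 2)) (hi : i ≠ i₀) : A.share t (J i) = A.share t' (J i) := by
      have := hshare i hi
      rcases hω : ω i with j | y' <;> simp [showVertex, hω] at this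
      grind
    have secret_eq : A.secret t = A.secret t' := by
      refine A.secret_eq ((Finset.univ.erase i₀).image J) ?_ t t' ?_
      · rw [Finset.card_image_of_injOn (hJ.mono fun i hi => by simpa using hi)]
        simp
      · simpa using share_eq
    rcases hω : ω i₀ with j | y' <;> simp [showVertex, hω, secret_eq] at hbit
    grind
  · rcases hanchor with h | ⟨i, hi⟩
    · have := h 0
      rcases hω : ω 0 with j | y <;> simp [showVertex, hω] at this
    · rcases hω : ω i with j | y <;> simp [showVertex, hω] at hi

lemma showVertex_comp_insertNth_mem_edges (A : ThresholdScheme T ι F (κ → Bool) r) (t : T)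
    (i : Fin (r + 2)) (y : κ) (J : Fin (r + 1) ↪ ι) :
    A.showVertex t (A.secret t) ∘ (i.insertNth (.inr y) fun l => .inl (J l)) ∈
      A.hypergraph.edges := by
  refine Or.inl ⟨t, i, y, by simp [showVertex], i.insertNth (J 0) J, ?_, fun a ha => ?_⟩
  · intro a ha b hb hab
    obtain ⟨l, rfl⟩ := Fin.exists_succAbove_eq ha
    obtain ⟨l', rfl⟩ := Fin.exists_succAbove_eq hb
    simp only [Fin.insertNth_apply_succAbove] at hab
    rw [J.injective hab]
  · obtain ⟨l, rfl⟩ := Fin.exists_succAbove_eq ha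
    simp [showVertex]

end ThresholdScheme

lemma one_sub_le_descFactorial_div_pow {K j : ℕ} (hK : 0 < K) (hj : j ≤ K) (s : ℕ) :
    1 - j * ((s + j) / (K + s) : ℝ) ≤ K.descFactorial j / (K + s : ℝ) ^ j := by
  have hKs : (0 : ℝ) < K + s := by positivity
  have hjK : (j : ℝ) ≤ K := mod_cast hj
  have ratio_le_one : (s + j : ℝ) / (K + s) ≤ 1 := (div_le_one hKs).2 (by linarith)
  calc 1 - j * ((s + j) / (K + s) : ℝ)
      = 1 + j * -((s + j) / (K + s) : ℝ) := by ring
    _ ≤ (1 + -((s + j) / (K + s) : ℝ)) ^ j := one_add_mul_le_pow (by linarith) j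
    _ = ((K - j : ℕ) : ℝ) ^ j / (K + s) ^ j := by
        rw [← div_pow, Nat.cast_sub hj]
        congr 1
        field_simp
        ring
    _ ≤ K.descFactorial j / (K + s : ℝ) ^ j := by
        gcongr
        exact_mod_cast (Nat.pow_le_pow_left (by lia) j).trans (Nat.pow_sub_le_descFactorial K j)

lemma injective_insertNth_inr_inl {ι κ : Type*} {n : ℕ} : Function.Injective
    fun x : Fin (n + 1) × κ × (Fin n ↪ ι) =>
      (x.1.insertNth (.inr x.2.1) fun l => .inl (x.2.2 l) : Fin (n + 1) → ι ⊕ κ) := by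
  rintro ⟨i, y, J⟩ ⟨i', y', J'⟩ h
  obtain rfl : i = i' := by
    by_contra hne
    obtain ⟨l, rfl⟩ := Fin.exists_succAbove_eq hne
    simpa using congrFun h (i'.succAbove l)
  obtain ⟨hy, hJ⟩ := (Fin.insertNth_inj (α := fun _ => ι ⊕ κ)).1 h
  obtain rfl := Sum.inr_injective hy
  obtain rfl : J = J' := DFunLike.ext _ _ fun l => Sum.inl_injective (congrFun hJ l)
  rfl

open Classical in
/-- The trace of a set of vertices on the possible values of the bits of the secret, where the
vertices of the dealings are embedded by `e`. -/
noncomputable def bitTrace {V ι F κ : Type*} [Fintype κ] (e : DealingVertex ι F κ ↪ V)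
    (D : Finset V) : Finset (κ × Bool) :=
  Finset.univ.filter fun p => e (.bit p.1 p.2) ∈ D

namespace ThresholdScheme

variable {T ι F κ V : Type*} {r : ℕ} [Fintype ι] [Fintype κ] [Nonempty κ]

/-- The distribution that shows, uniformly at random, a share of the dealing `t` or a bit of `τ`. -/
noncomputable def showPMF (A : ThresholdScheme T ι F (κ → Bool) r) (t : T) (τ : κ → Bool) :
    PMF (DealingVertex ι F κ) :=
  (PMF.uniformOfFintype (ι ⊕ κ)).map (A.showVertex t τ)

section EdgeFreq

variable [Fintype F]

lemma edgeFreq_showPMF_compl (A : ThresholdScheme T ι F (κ → Bool) r) (t : T) :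
    edgeFreq (A.showPMF t fun y => !A.secret t y) A.hypergraph = 0 := by
  rw [edgeFreq, showPMF, iidProb_map]
  exact Finset.sum_eq_zero fun ω _ => if_neg (A.showVertex_comp_notMem_edges t ω)

lemma le_edgeFreq_showPMF (A : ThresholdScheme T ι F (κ → Bool) r) (t : T) :
    (r + 2 : ℝ) * (Fintype.card κ * (Fintype.card ι).descFactorial (r + 1)) /
        (Fintype.card ι + Fintype.card κ) ^ (r + 2) ≤
      edgeFreq (A.showPMF t (A.secret t)) A.hypergraph := by
  rw [edgeFreq, showPMF, iidProb_map]
  refine (le_of_eq ?_).trans (card_div_pow_le_iidProb_uniformOfFintype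
    ⟨_, injective_insertNth_inr_inl⟩ fun x => A.showVertex_comp_insertNth_mem_edges t x.1 x.2.1
      x.2.2)
  simp only [Fintype.card_prod, Fintype.card_fin, Fintype.card_embedding_eq, Fintype.card_sum]
  push_cast
  ring

lemma eighth_le_edgeFreq_showPMF (A : ThresholdScheme T ι F (κ → Bool) r) (t : T)
    (hι : Fintype.card ι = (2 * r + 3) * Fintype.card κ) (hκ : 2 * r + 2 ≤ Fintype.card κ) :
    1 / 8 ≤ edgeFreq (A.showPMF t (A.secret t)) A.hypergraph := by
  refine le_trans ?_ (A.le_edgeFreq_showPMF t)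
  set K := Fintype.card ι
  set m := Fintype.card κ
  have hm : 0 < m := by lia
  have hK : (K : ℝ) + m = 2 * (r + 2) * m := by
    rw [hι]
    push_cast
    ring
  have shares_distinct : 1 / 4 ≤ K.descFactorial (r + 1) / (K + m : ℝ) ^ (r + 1) := by
    refine le_trans ?_ (one_sub_le_descFactorial_div_pow (by nlinarith) (by nlinarith) m)
    have ratio_le : (r + 1 : ℕ) * ((m + (r + 1 : ℕ)) / (K + m) : ℝ) ≤ 3 / 4 := by
      rw [← mul_div_assoc, hK, div_le_iff₀ (by positivity)]
      have : (2 * r + 2 : ℝ) ≤ m := mod_cast hκ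
      push_cast
      nlinarith
    linarith
  calc (1 : ℝ) / 8 = (r + 2) * m / (2 * (r + 2) * m) * (1 / 4) := by field_simp; norm_num
    _ ≤ (r + 2) * m / (2 * (r + 2) * m) * (K.descFactorial (r + 1) / (K + m : ℝ) ^ (r + 1)) := by
        gcongr
    _ = (r + 2 : ℝ) * (m * K.descFactorial (r + 1)) / (K + m) ^ (r + 2) := by
        rw [← hK, div_mul_div_comm, ← pow_succ']
        ring

end EdgeFreq

lemma mem_support_showPMF_map {A : ThresholdScheme T ι F (κ → Bool) r} {t : T} {τ : κ → Bool}
    {e : DealingVertex ι F κ ↪ V} {v : V} (hv : v ∈ ((A.showPMF t τ).map e).support) :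
    ∃ p, e (A.vertexAt t p) = v := by
  simp only [showPMF, PMF.map_comp, PMF.support_map, Set.mem_image] at hv
  obtain ⟨ω, -, rfl⟩ := hv
  exact ⟨_, congrArg e (A.showVertex_eq_vertexAt t τ ω).symm⟩

lemma sum_showPMF_sub_compl [Finite V] [DecidableEq κ] (A : ThresholdScheme T ι F (κ → Bool) r)
    (t : T) (τ : κ → Bool) (e : DealingVertex ι F κ ↪ V) (D : Finset V) :
    ∑ v ∈ D, (((A.showPMF t τ).map e v).toReal -
        ((A.showPMF t fun y => !τ y).map e v).toReal) =
      correlation (bitTrace e D) τ / (Fintype.card ι + Fintype.card κ) := by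
  classical
  have := Fintype.ofFinite V
  have sum_eq (τ : κ → Bool) : ∑ v ∈ D, ((A.showPMF t τ).map e v).toReal =
      ((∑ i, if e (.share i (A.share t i)) ∈ D then 1 else 0) +
        ∑ y, if e (.bit y (τ y)) ∈ D then 1 else 0) / (Fintype.card ι + Fintype.card κ) := by
    have := sum_map_mul (PMF.uniformOfFintype (ι ⊕ κ)) (e ∘ A.showVertex t τ)
      fun v => if v ∈ D then 1 else 0
    simp only [mul_ite, mul_one, mul_zero, Finset.sum_ite_mem, Finset.univ_inter] at this
    rw [showPMF, PMF.map_comp, this, Fintype.sum_sum_type, add_div, Finset.sum_div, Finset.sum_div]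
    simp [showVertex, ite_div, ENNReal.toReal_add]
  have correlation_eq : correlation (bitTrace e D) τ =
      (∑ y, if e (.bit y (τ y)) ∈ D then 1 else 0) -
        ∑ y, if e (.bit y (!τ y)) ∈ D then 1 else 0 := by
    simp [correlation, bitTrace, Finset.sum_sub_distrib]
  rw [Finset.sum_sub_distrib, sum_eq, sum_eq, correlation_eq, ← sub_div, add_sub_add_left_eq_sub]

end ThresholdScheme

lemma card_filter_exists_eq_inl_le {ι β : Type*} [Fintype ι] [DecidableEq ι] [DecidableEq β]
    {l : ℕ} (u : Fin l → ι ⊕ β) : (Finset.univ.filter fun j => ∃ i, u i = .inl j).card ≤ l := by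
  rw [← Finset.card_map Function.Embedding.inl]
  calc _ ≤ (Finset.univ.image u).card := Finset.card_le_card fun p hp => by
          obtain ⟨j, hj, rfl⟩ := Finset.mem_map.1 hp
          simpa using hj
    _ ≤ l := Finset.card_image_le.trans (by simp)

lemma card_image_bitTrace_le {V ι F κ : Type*} [DecidableEq V] [Fintype κ] [DecidableEq κ]
    (e : DealingVertex ι F κ ↪ V) (𝒜 : Finset (Finset V)) :
    (𝒜.image (bitTrace e)).card ≤ (2 * Fintype.card κ + 1) ^ 𝒜.vcDim := by
  let bitVertex : κ × Bool ↪ V := ⟨fun p => e (.bit p.1 p.2), fun p q h => by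
    simpa [Prod.ext_iff] using h⟩
  have image_eq : 𝒜.image (bitTrace e) = traces 𝒜 bitVertex :=
    Finset.image_congr fun D _ => by
      ext p
      simp only [bitTrace, Finset.mem_filter, Finset.mem_univ, true_and]
      rfl
  rw [image_eq, mul_comm, ← Fintype.card_bool, ← Fintype.card_prod]
  exact card_traces_le 𝒜 bitVertex

namespace ThresholdScheme

section Separation

variable {T ι F κ V : Type*} {r : ℕ} [Fintype ι] [Fintype κ]
  [Fintype V]

lemma exists_forall_abs_correlation_link_le [Finite T] [Nonempty T]
    (A : ThresholdScheme T ι F (κ → Bool) r) [DecidableEq κ]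
    (e : DealingVertex ι F κ ↪ V) (ℋ : Set (KHypergraph V (r + 1))) {η : ℝ}
    (hη : 0 ≤ η)
    (hsmall : (Fintype.card ι + 2 * Fintype.card κ : ℝ) ^ r *
      ((2 * Fintype.card κ + 1) ^ gVC (r + 1) ℋ *
        (2 * Real.exp (-(η ^ 2 * Fintype.card κ / 2)))) < 1) :
    ∃ t, ∀ u : Fin r → ι ⊕ κ × Bool, ∀ h ∈ ℋ,
      |correlation (bitTrace e (h.link (e ∘ A.vertexAt t ∘ u))) (A.secret t)| ≤
        η * Fintype.card κ := by
  classical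
  obtain ⟨t, ht⟩ := A.exists_forall_abs_correlation_le (I := Fin r → ι ⊕ κ × Bool)
    (fun u => Finset.univ.filter fun j => ∃ i, u i = .inl j)
    (fun u => card_filter_exists_eq_inl_le u)
    (fun u t => (linkFamily ℋ (e ∘ A.vertexAt t ∘ u)).image (bitTrace e))
    (fun u t t' h => by
      rw [vertexAt_comp_eq fun i j hij => h j (Finset.mem_filter.2 ⟨Finset.mem_univ j, i, hij⟩)])
    (M := (2 * Fintype.card κ + 1) ^ gVC (r + 1) ℋ)
    (fun u t => by
      have := (card_image_bitTrace_le e (linkFamily ℋ (e ∘ A.vertexAt t ∘ u))).trans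
        (Nat.pow_le_pow_right (Nat.succ_pos _) (by convert vcDim_linkFamily_le_gVC ℋ _))
      exact_mod_cast this)
    hη (by convert hsmall using 2; simp [mul_comm])
  exact ⟨t, fun u h hh => ht u _ (Finset.mem_image_of_mem _ (mem_linkFamily.2 ⟨h, hh, rfl⟩))⟩

lemma ipm_showPMF_le [Nonempty κ] [DecidableEq κ] {A : ThresholdScheme T ι F (κ → Bool) r}
    {e : DealingVertex ι F κ ↪ V} {ℋ : Set (KHypergraph V (r + 1))} {t : T} {B : ℝ} (hB : 0 ≤ B)
    (h : ∀ u : Fin r → ι ⊕ κ × Bool, ∀ h ∈ ℋ,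
      |correlation (bitTrace e (h.link (e ∘ A.vertexAt t ∘ u))) (A.secret t)| ≤ B) :
    ipm ℋ ((A.showPMF t (A.secret t)).map e) ((A.showPMF t fun y => !A.secret t y).map e) ≤
      (r + 1) * (B / (Fintype.card ι + Fintype.card κ)) := by
  refine ipm_le (by positivity) fun g hg => abs_edgeFreq_sub_le fun u hu => ?_
  choose p hp using fun i => (hu i).elim mem_support_showPMF_map mem_support_showPMF_map
  obtain rfl : e ∘ A.vertexAt t ∘ p = u := funext hp
  rw [sum_showPMF_sub_compl, abs_div, abs_of_nonneg (by positivity : (0 : ℝ) ≤ _ + _)]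
  gcongr
  exact h p g hg

lemma eighth_le_ipm_showPMF [Finite F] [Nonempty κ] (A : ThresholdScheme T ι F (κ → Bool) r)
    (e : DealingVertex ι F κ ↪ V) (t : T) (hι : Fintype.card ι = (2 * r + 3) * Fintype.card κ)
    (hκ : 2 * r + 2 ≤ Fintype.card κ) :
    1 / 8 ≤ ipm {A.hypergraph.map e} ((A.showPMF t (A.secret t)).map e)
      ((A.showPMF t fun y => !A.secret t y).map e) := by
  have := Fintype.ofFinite F
  rw [ipm_singleton, edgeFreq_map, edgeFreq_map, edgeFreq_showPMF_compl, sub_zero]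
  exact (A.eighth_le_edgeFreq_showPMF t hι hκ).trans (le_abs_self _)

theorem one_le_of_mul_ipm_le [Finite T] [Nonempty T] [Finite F] [Nonempty κ]
    (A : ThresholdScheme T ι F (κ → Bool) r)
    (e : DealingVertex ι F κ ↪ V) (hι : Fintype.card ι = (2 * r + 3) * Fintype.card κ)
    (hκ : 2 * r + 2 ≤ Fintype.card κ) {ε : ℝ} (hε : 0 < ε) {ℋ : Set (KHypergraph V (r + 1))}
    (H : ∀ p₁ p₂, ε * ipm {A.hypergraph.map e} p₁ p₂ ≤ ipm ℋ p₁ p₂) :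
    1 ≤ (Fintype.card ι + 2 * Fintype.card κ : ℝ) ^ r *
      ((2 * Fintype.card κ + 1) ^ gVC (r + 1) ℋ *
        (2 * Real.exp (-((ε / 4) ^ 2 * Fintype.card κ / 2)))) := by
  classical
  by_contra! hsmall
  obtain ⟨t, ht⟩ := A.exists_forall_abs_correlation_link_le e ℋ (by positivity) hsmall
  set P := (A.showPMF t (A.secret t)).map e
  set P' := (A.showPMF t fun y => !A.secret t y).map e
  have small : ipm ℋ P P' < ε / 8 :=
    calc ipm ℋ P P'
        ≤ (r + 1) * (ε / 4 * Fintype.card κ / (Fintype.card ι + Fintype.card κ)) :=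
          ipm_showPMF_le (by positivity) ht
      _ = ε / 8 * ((r + 1) / (r + 2)) := by
          rw [hι]
          push_cast
          field_simp
          ring
      _ < ε / 8 := mul_lt_of_lt_one_right (by positivity)
          ((div_lt_one (by positivity)).2 (by linarith))
  have large : ε / 8 ≤ ε * ipm {A.hypergraph.map e} P P' := by
    have := mul_le_mul_of_nonneg_left (A.eighth_le_ipm_showPMF e t hι hκ) hε.le
    linarith
  exact absurd (large.trans (H P P')) (not_le.2 small)

end Separation

end ThresholdScheme

section Parameters

lemma sq_le_two_pow {m : ℕ} (hm : 4 ≤ m) : m ^ 2 ≤ 2 ^ m := by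
  induction m, hm using Nat.le_induction with
  | base => norm_num
  | succ m hm ih =>
    rw [pow_succ 2]
    nlinarith

lemma mul_lt_two_pow {r m : ℕ} (hm : 2 * r + 4 ≤ m) : (2 * r + 3) * m < 2 ^ m := by
  have := sq_le_two_pow (by lia : 4 ≤ m)
  nlinarith

lemma mul_two_pow_add_le_four_pow {r m : ℕ} (hm : 2 * r + 4 ≤ m) :
    (2 * r + 3) * m * 2 ^ m + 2 * m + 3 ≤ 4 ^ m := by
  have sq_le : m ^ 2 ≤ 2 ^ m := sq_le_two_pow (by lia)
  calc (2 * r + 3) * m * 2 ^ m + 2 * m + 3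
      ≤ (2 * r + 3) * m * 2 ^ m + m * 2 ^ m := by nlinarith
    _ ≤ m ^ 2 * 2 ^ m := by
        rw [← add_mul]
        gcongr
        nlinarith
    _ ≤ 2 ^ m * 2 ^ m := by gcongr
    _ = 4 ^ m := (mul_pow 2 2 m).symm

lemma four_pow_le {n m : ℕ} (hn : 0 < n) (hm : m ≤ Real.log n / 2) : 4 ^ m ≤ n := by
  have four_le : (4 : ℝ) ≤ Real.exp 1 ^ 2 := by
    nlinarith [Real.add_one_le_exp (1 : ℝ)]
  have : (4 : ℝ) ^ m ≤ n :=
    calc (4 : ℝ) ^ m ≤ (Real.exp 1 ^ 2) ^ m := by gcongr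
      _ = Real.exp (2 * m) := by rw [← pow_mul, ← Real.exp_nat_mul]; push_cast; ring_nf
      _ ≤ Real.exp (Real.log n) := Real.exp_le_exp.2 (by linarith)
      _ = n := Real.exp_log (mod_cast hn)
  exact_mod_cast this

lemma log_four_mul_le {x : ℝ} (hx : 0 < x) : Real.log (4 * x) ≤ 4 * √x := by
  calc Real.log (4 * x) = 2 * Real.log (2 * √x) := by
        rw [show 4 * x = (2 * √x) ^ 2 by rw [mul_pow, Real.sq_sqrt hx.le]; norm_num, Real.log_pow]
        norm_num
    _ ≤ 2 * (2 * √x) := by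
        gcongr
        exact Real.log_le_self (by positivity)
    _ = 4 * √x := by ring

lemma sq_mul_sqrt_le {r m d : ℕ} {ε : ℝ} (hm : 2 * r + 4 ≤ m)
    (h : 1 ≤ ((2 * r + 3) * m + 2 * m : ℝ) ^ r *
      ((2 * m + 1) ^ d * (2 * Real.exp (-((ε / 4) ^ 2 * m / 2))))) :
    ε ^ 2 * √m ≤ 128 * (2 * r + d + 1) := by
  have hm' : (2 * r + 4 : ℝ) ≤ m := mod_cast hm
  have hm₀ : (0 : ℝ) < m := by linarith
  have hs : 0 < √(m : ℝ) := Real.sqrt_pos.2 hm₀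
  have one_le : 1 ≤ (4 * m : ℝ) ^ (2 * r + d + 1) * Real.exp (-(ε ^ 2 * m / 32)) :=
    calc _ ≤ _ := h
      _ ≤ ((4 * m) ^ 2 : ℝ) ^ r *
          ((4 * m) ^ d * ((4 * m) * Real.exp (-((ε / 4) ^ 2 * m / 2)))) := by
          gcongr <;> nlinarith
      _ = _ := by
          rw [← pow_mul]
          ring_nf
  have exponent_le : ε ^ 2 * m / 32 ≤ (2 * r + d + 1) * Real.log (4 * m) := by
    have := Real.log_nonneg one_le
    rw [Real.log_mul (by positivity) (Real.exp_ne_zero _), Real.log_pow, Real.log_exp] at this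
    push_cast at this
    linarith
  have : ε ^ 2 * √m * √m ≤ 128 * (2 * r + d + 1) * √m :=
    calc ε ^ 2 * √m * √m = 32 * (ε ^ 2 * m / 32) := by
          rw [mul_assoc, Real.mul_self_sqrt hm₀.le]
          ring
      _ ≤ 32 * ((2 * r + d + 1) * (4 * √m)) := by
          gcongr
          exact exponent_le.trans (by gcongr; exact log_four_mul_le hm₀)
      _ = 128 * (2 * r + d + 1) * √m := by ring
  exact le_of_mul_le_mul_right this hs

lemma sq_div_mul_sqrt_le_of_le_four_mul {r m d : ℕ} {ε L : ℝ} (hd : 1 ≤ d) (hm : 2 * r + 4 ≤ m)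
    (hL : L ≤ 4 * m)
    (h : 1 ≤ ((2 * r + 3) * m + 2 * m : ℝ) ^ r *
      ((2 * m + 1) ^ d * (2 * Real.exp (-((ε / 4) ^ 2 * m / 2))))) :
    1 / 512 * (ε ^ 2 / (r + 2) * √L) ≤ d := by
  have hd' : (1 : ℝ) ≤ d := mod_cast hd
  have sqrt_le : √L ≤ 2 * √m := by
    rw [Real.sqrt_le_left (by positivity), mul_pow, Real.sq_sqrt m.cast_nonneg]
    linarith
  have : ε ^ 2 * √L ≤ 512 * ((r + 2 : ℝ) * d) :=
    calc ε ^ 2 * √L ≤ 2 * (ε ^ 2 * √m) := by nlinarith [sq_nonneg ε]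
      _ ≤ 2 * (128 * (2 * r + d + 1) : ℝ) := by linarith [sq_mul_sqrt_le hm h]
      _ ≤ 512 * ((r + 2 : ℝ) * d) := by nlinarith [(r.cast_nonneg : (0 : ℝ) ≤ r)]
  calc 1 / 512 * (ε ^ 2 / (r + 2) * √L) = ε ^ 2 * √L / (512 * (r + 2)) := by field_simp
    _ ≤ (d : ℝ) := by
        rw [div_le_iff₀ (by positivity)]
        linarith

lemma sq_div_mul_sqrt_le_one {r : ℕ} {ε L : ℝ} (hε : 0 ≤ ε) (hε' : ε ≤ 1)
    (hL : L ≤ 4 * (r + 2)) : 1 / 512 * (ε ^ 2 / (r + 2) * √L) ≤ 1 := by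
  have sqrt_le : √L ≤ 2 * (r + 2) := by
    rw [Real.sqrt_le_left (by positivity)]
    nlinarith [(r.cast_nonneg : (0 : ℝ) ≤ r)]
  calc 1 / 512 * (ε ^ 2 / (r + 2) * √L) ≤ 1 / 512 * (1 ^ 2 / (r + 2) * (2 * (r + 2))) := by gcongr
    _ ≤ 1 := by
        field_simp
        norm_num

end Parameters

theorem exists_isAnchored_and_one_le {V : Type*} [Fintype V] {r m : ℕ} (hm : 2 * r + 4 ≤ m)
    (hV : 4 ^ m ≤ Fintype.card V) :
    ∃ (g : KHypergraph V (r + 2)) (loop base hub : V), IsAnchored g.edges loop base hub ∧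
      ∀ ε : ℝ, 0 < ε → ∀ ℋ : Set (KHypergraph V (r + 1)),
        (∀ p₁ p₂, ε * ipm {g} p₁ p₂ ≤ ipm ℋ p₁ p₂) →
          1 ≤ ((2 * r + 3) * m + 2 * m : ℝ) ^ r *
            ((2 * m + 1) ^ gVC (r + 1) ℋ * (2 * Real.exp (-((ε / 4) ^ 2 * m / 2)))) := by
  have : Fact (Nat.Prime 2) := ⟨Nat.prime_two⟩
  let F := GaloisField 2 m
  have := Fintype.ofFinite F
  have := Fintype.ofFinite Fˣ
  have : NeZero m := ⟨by lia⟩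
  have card_F : Fintype.card F = 2 ^ m := by
    rw [← Nat.card_eq_fintype_card, GaloisField.card 2 m (NeZero.ne m)]
  have bits : F ≃ (Fin m → Bool) := Fintype.equivOfCardEq (by simp [card_F])
  obtain ⟨x⟩ : Nonempty (Fin ((2 * r + 3) * m) ↪ Fˣ) := by
    refine Function.Embedding.nonempty_of_card_le ?_
    rw [Fintype.card_fin, ← Nat.card_eq_fintype_card, Nat.card_units, Nat.card_eq_fintype_card,
      card_F]
    exact Nat.le_sub_one_of_lt (mul_lt_two_pow hm)
  obtain ⟨e⟩ : Nonempty (DealingVertex (Fin ((2 * r + 3) * m)) F (Fin m) ↪ V) := by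
    refine Function.Embedding.nonempty_of_card_le ?_
    rw [card_dealingVertex, card_F, Fintype.card_fin, Fintype.card_fin]
    exact (mul_two_pow_add_le_four_pow hm).trans hV
  have : Finite (Polynomial.degreeLT F (r + 1)) :=
    .of_equiv _ (Polynomial.degreeLTEquiv F (r + 1)).symm.toEquiv
  let A := shamirScheme x bits r
  refine ⟨A.hypergraph.map e, _, _, _, A.isAnchored_hypergraph.map e, fun ε hε ℋ H => ?_⟩
  simpa using A.one_le_of_mul_ipm_le e (by simp) (by simp; lia) hε H

theorem exists_sq_div_mul_sqrt_log_le_gVC {V : Type*} [Fintype V] (r : ℕ)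
    (hV : 3 ≤ Fintype.card V) :
    ∃ g : KHypergraph V (r + 2), ∀ ε : ℝ, 0 < ε → ∀ ℋ : Set (KHypergraph V (r + 1)),
      (∀ p₁ p₂, ε * ipm {g} p₁ p₂ ≤ ipm ℋ p₁ p₂) →
        1 / 512 * (ε ^ 2 / (r + 2) * √(Real.log (Fintype.card V))) ≤ gVC (r + 1) ℋ := by
  set L := Real.log (Fintype.card V)
  have floor_le : (⌊L / 2⌋₊ : ℝ) ≤ L / 2 :=
    Nat.floor_le (div_nonneg (Real.log_natCast_nonneg _) two_pos.le)
  have lt_floor : L / 2 < ⌊L / 2⌋₊ + 1 := Nat.lt_floor_add_one _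
  rcases le_or_gt (2 * r + 4) ⌊L / 2⌋₊ with hm | hm
  · obtain ⟨g, loop, base, hub, hg, one_le⟩ :=
      exists_isAnchored_and_one_le hm (four_pow_le (by lia) floor_le)
    refine ⟨g, fun ε hε ℋ H => ?_⟩
    have : (4 : ℝ) ≤ ⌊L / 2⌋₊ := mod_cast le_trans (by lia) hm
    exact sq_div_mul_sqrt_le_of_le_four_mul (hg.one_le_gVC hε H) hm (by linarith)
      (one_le ε hε ℋ H)
  · obtain ⟨φ⟩ : Nonempty (Fin 3 ↪ V) := Function.Embedding.nonempty_of_card_le (by simpa)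
    let g : KHypergraph V (r + 2) :=
      ⟨anchorEdges (r + 2) (φ 0) (φ 2), fun π _ => comp_mem_anchorEdges π⟩
    have hg : IsAnchored g.edges (φ 0) (φ 1) (φ 2) :=
      isAnchored_anchorEdges (by simp) (by simp) (by simp)
    refine ⟨g, fun ε hε ℋ H => ?_⟩
    have : (⌊L / 2⌋₊ + 1 : ℝ) ≤ 2 * r + 4 := mod_cast hm
    exact (sq_div_mul_sqrt_le_one hε.le (hg.le_one_of_mul_ipm_le H) (by linarith)).trans
      (mod_cast hg.one_le_gVC hε H)

theorem mainTheorem7 :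
    ∃ C : ℝ, 0 < C ∧ ∃ c : ℝ, 0 < c ∧
      ∀ (k : ℕ), 2 ≤ k → ∀ (V : Type*) [Fintype V], 3 ≤ Fintype.card V →
        ∃ 𝒢 : Set (KHypergraph V k),
          𝒢.ncard = 1 ∧
          (∃ m : ℝ → ℝ → ℕ, HasSampleComplexity 𝒢 m ∧
            ∀ ε δ : ℝ, 0 < ε → ε < 1 → 0 < δ → δ < 1 →
              (m ε δ : ℝ) ≤ C * (((k : ℝ) ^ 2 + Real.log (1 / δ)) / ε ^ 2)) ∧
          ∀ (ε : ℝ), 0 < ε → ∀ ℋ : Set (KHypergraph V (k - 1)),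
            (∀ p₁ p₂ : PMF V, ε * ipm 𝒢 p₁ p₂ ≤ ipm ℋ p₁ p₂) →
              c * (ε ^ 2 / (k : ℝ) ^ 2 * Real.sqrt (Real.log (Fintype.card V))) ≤
                (gVC (k - 1) ℋ : ℝ) := by
  refine ⟨1, one_pos, 1 / 512, by norm_num, fun k hk V _ hV => ?_⟩
  obtain ⟨r, rfl⟩ := Nat.exists_eq_add_of_le' hk
  obtain ⟨g, hg⟩ := exists_sq_div_mul_sqrt_log_le_gVC r hV
  refine ⟨{g}, Set.ncard_singleton g, ⟨fun _ _ => 0, hasSampleComplexity_singleton g, ?_⟩, ?_⟩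
  · intro ε δ _ _ hδ hδ'
    have : 0 ≤ Real.log (1 / δ) := Real.log_nonneg ((one_le_div hδ).2 hδ'.le)
    rw [Nat.cast_zero]
    positivity
  · refine fun ε hε ℋ H => le_trans ?_ (hg ε hε ℋ H)
    push_cast
    gcongr
    exact le_self_pow₀ (by linarith [(r.cast_nonneg : (0 : ℝ) ≤ r)]) two_ne_zero
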